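/- Let $q\ge 5$ be a prime power and let $k\ge 1$, $n\ge 5$, $t$ be integers with $n\le q$, $k\le n-4$ and $1\le t\le n-k-3$. Let $\zeta=(\zeta_0,\dots,\zeta_{n-1})$ be a tuple of distinct elements and $v=(v_0,\dots,v_{n-1})$ a tuple of nonzero elements of $\mathbb F_q$, and let $\mathrm{GRS}_k(\zeta,v)=\{(v_0f(\zeta_0),\dots,v_{n-1}f(\zeta_{n-1})) : f\in\mathbb F_q[x],\ \deg f<k\}$. *Definitions.* A matrix over $\mathbb F_q[D]$ is *basic* if it has a polynomial right inverse, and *reduced basic* if moreover the sum of its row degrees (the largest degree of an entry of a row) is smallest among all basic matrices generating the same code $\{u(D)G(D)\}$. *Splitting* a matrix $H$ over $\mathbb F_q$ means distributing its rows over disjoint submatrices $H_0,\dots,H_m$ and forming $G(D)=H_0+\tilde H_1D+\dots+\tilde H_mD^m$, where $\tilde H_i$ is $H_i$ padded with zero rows (in any positions) to the number of rows of $H_0$. The *dual* of a code $V\subseteq\mathbb F_q[D]^n$ is $V^\perp=\{u\in\mathbb F_q[D]^n : \sum_i u_i(D)v_i(1/D)=0 \text{ for all } v\in V\}$. An *asymmetric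 quantum convolutional code (AQCC)* with parameters $[(n,K,\mu;\gamma,(d_z)_f/(d_x)_f)]_q$ is given by a reduced basic stabilizer matrix $S(D)=(X(D)\mid Z(D))$ over $\mathbb F_q[D]$ with $n-K$ rows and $2n$ columns such that $X(D)Z(1/D)^{T}-Z(D)X(1/D)^{T}=0$; $\mu$ is the largest row degree and $\gamma$ the sum of the row degrees of $S(D)$. A Pauli error $(a(D)\mid b(D))\in\mathbb F_q[D]^{2n}$ is undetectable if $a(D)Z(1/D)^T-b(D)X(1/D)^T=0$ and $(a\mid b)$ is not in the $\mathbb F_q[D]$-row space of $S(D)$; $(d_z)_f$ (resp. $(d_x)_f$) is the minimum weight of an undetectable phase-shift error $(0\mid b)$ (resp. qudit-flip error $(a\mid 0)$), the weight being the number of nonzero coefficients. *Claim.* There are nonzero $w_0,\dots,w_{n-1}\in\mathbb F_q$ such that $H=(w_i\zeta_i^{\,j})_{0\le j\le n-k-1,\ 0\le i\le n-1}$ is a parity-check matrix of $\mathrm{GRS}_k(\zeta,v)$, a splitting of $H$ into a reduced basic $(n-k-2)\times n$ matrix $G_1(D)$, a splitting of the first $t+1$ rows of $H$ into a reduced basic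 $t\times n$ matrix $G_2(D)$ whose rows are $t$ distinct rows of $G_1(D)$, and a reduced basic generator matrix $H_1(D)$ of the dual of the code generated by $G_1(D)$, such that $$\begin{pmatrix} G_2(D) & | & 0\\ 0 & | & H_1(D)\end{pmatrix}$$ is the stabilizer matrix of an AQCC with parameters $[(n,\,n-t-k-2,\,\mu^*;\,3,\,(d_z)_f/(d_x)_f)]_q$ for some memory $\mu^*$, where $(d_z)_f\ge t+2$ and $(d_x)_f\ge k+1$. (Consequently the larger of the two free distances is at least $\max(t+2,k+1)$ and the smaller one at least $\min(t+2,k+1)$.) -/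

import Mathlib

open Polynomial
open scoped LaurentPolynomial

namespace AQCC

noncomputable section

/-! ### Classical convolutional codes -/

/-- `∑ᵢ uᵢ(D) vᵢ(1/D)`, a Laurent polynomial. Its coefficient at `D ^ l` is the Euclidean inner
product of the coefficient sequences of `u` and of the shifted word `D ^ l v`. -/
def conjPairing {F : Type*} [Field F] {n : ℕ} (u v : Fin n → F[X]) : F[T;T⁻¹] :=
  ∑ i, toLaurent (u i) * LaurentPolynomial.invert (toLaurent (v i))

/-- The convolutional code `{u(D) G(D)}` generated by a polynomial matrix `G(D)`. -/
def code {F : Type*} [Field F] {ι κ : Type*} [Fintype ι] (G : Matrix ι κ F[X]) :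
    Submodule F[X] (κ → F[X]) :=
  LinearMap.range G.vecMulLinear

/-- `u` lies in the Euclidean dual of `C` when it is orthogonal to all words of `C` and to all
their time shifts. -/
def InDual {F : Type*} [Field F] {n : ℕ} (C : Submodule F[X] (Fin n → F[X]))
    (u : Fin n → F[X]) : Prop :=
  ∀ v ∈ C, conjPairing u v = 0

/-- A polynomial matrix is basic if it has a polynomial right inverse. -/
def IsBasic {F : Type*} [Field F] {ι κ : Type*} [DecidableEq ι] [Fintype κ]
    (G : Matrix ι κ F[X]) : Prop :=
  ∃ R : Matrix κ ι F[X], G * R = 1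

/-- The constraint length of row `i`: the largest degree of its entries. -/
def rowDegree {F : Type*} [Field F] {ι κ : Type*} [Fintype κ]
    (G : Matrix ι κ F[X]) (i : ι) : ℕ :=
  Finset.univ.sup fun j => (G i j).natDegree

/-- The overall constraint length: the sum of the row degrees. -/
def overallConstraintLength {F : Type*} [Field F] {ι κ : Type*} [Fintype ι] [Fintype κ]
    (G : Matrix ι κ F[X]) : ℕ :=
  ∑ i, rowDegree G i

/-- The memory: the largest row degree. -/
def memory {F : Type*} [Field F] {ι κ : Type*} [Fintype ι] [Fintype κ]
    (G : Matrix ι κ F[X]) : ℕ :=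
  Finset.univ.sup fun i => rowDegree G i

/-- A reduced basic matrix: basic, and of smallest overall constraint length among all basic
generator matrices of the same code. Its overall constraint length is then the degree. -/
def IsReducedBasic {F : Type*} [Field F] {ι κ : Type*} [Fintype ι] [DecidableEq ι] [Fintype κ]
    (G : Matrix ι κ F[X]) : Prop :=
  IsBasic G ∧ ∀ G' : Matrix ι κ F[X], IsBasic G' → code G' = code G →
    overallConstraintLength G ≤ overallConstraintLength G'

/-- `G(D) = H̃₀ + H̃₁ D + ⋯ + H̃_μ D ^ μ` arises by splitting the rows of `H` into disjoint
submatrices `H₀, …, H_μ` and padding `H₁, …, H_μ` with zero rows. Row `j` of `H` becomes row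
`(σ j).1` of the coefficient of `D ^ (σ j).2`; the coefficient `H₀` has no zero padding. -/
def IsSplitting {F : Type*} [Field F] {m n r : ℕ} (H : Matrix (Fin m) (Fin n) F)
    (G : Matrix (Fin r) (Fin n) F[X]) : Prop :=
  ∃ σ : Fin m → Fin r × ℕ, Function.Injective σ ∧ (∀ a, ∃ j, σ j = (a, 0)) ∧
    ∀ a b, G a b = ∑ j, if (σ j).1 = a then monomial (σ j).2 (H j b) else 0

/-! ### Generalized Reed–Solomon codes -/

/-- The linear code `{(v₀ f(ζ₀), …, vₙ₋₁ f(ζₙ₋₁)) | deg f < k}`. -/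
def GRS {F : Type*} [Field F] {n : ℕ} (k : ℕ) (ζ v : Fin n → F) : Submodule F (Fin n → F) :=
  (degreeLT F k).map (LinearMap.pi fun i => v i • (Polynomial.leval (ζ i)))

/-- The matrix with `m` rows whose entry at `(j, i)` is `wᵢ ζᵢ ^ j`. -/
def grsMatrix {F : Type*} [Field F] {n : ℕ} (m : ℕ) (ζ w : Fin n → F) :
    Matrix (Fin m) (Fin n) F :=
  Matrix.of fun j i => w i * ζ i ^ (j : ℕ)

/-- `H` is a (full rank) parity check matrix of the block code `C`. -/
def IsParityCheckMatrix {F : Type*} [Field F] {m n : ℕ} (H : Matrix (Fin m) (Fin n) F)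
    (C : Submodule F (Fin n → F)) : Prop :=
  LinearIndependent F H.row ∧ ∀ c, c ∈ C ↔ H.mulVec c = 0

/-! ### Quantum convolutional stabilizer codes

A finitely supported Pauli error on a stream of frames of `n` qudits is, up to a phase, a pair
`(a(D) | b(D))` of polynomial words, here a function on `Fin n ⊕ Fin n`: on the qudit `i` of the
frame `m` it acts as `X(α) Z(β)`, with `α`, `β` the coefficients at `D ^ m` of `aᵢ`, `bᵢ`. -/

/-- The polynomial symplectic form `a(D) b'(1/D)ᵗ - b(D) a'(1/D)ᵗ`. It vanishes exactly if the
first error is symplectically orthogonal to every time shift of the second one. -/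
def symplecticPairing {F : Type*} [Field F] {n : ℕ} (e f : Fin n ⊕ Fin n → F[X]) : F[T;T⁻¹] :=
  conjPairing (fun i => e (Sum.inl i)) (fun i => f (Sum.inr i)) -
    conjPairing (fun i => e (Sum.inr i)) (fun i => f (Sum.inl i))

/-- The number of qudits on which the error differs from the identity. -/
def pauliWeight {F : Type*} [Field F] {n : ℕ} (e : Fin n ⊕ Fin n → F[X]) : ℕ :=
  open Classical in
  ∑ i, ((e (Sum.inl i)).support ∪ (e (Sum.inr i)).support).card

/-- An error is undetectable if it commutes with the stabilizer (zero syndrome) and does not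
belong to the stabilizer. -/
def IsUndetectable {F : Type*} [Field F] {n : ℕ} {ι : Type*} [Fintype ι]
    (S : Matrix ι (Fin n ⊕ Fin n) F[X]) (e : Fin n ⊕ Fin n → F[X]) : Prop :=
  (∀ i, symplecticPairing e (S i) = 0) ∧ e ∉ code S

/-- Errors built from the operators `Z(b)` only. -/
def IsPhaseShift {F : Type*} [Field F] {n : ℕ} (e : Fin n ⊕ Fin n → F[X]) : Prop :=
  ∀ i, e (Sum.inl i) = 0

/-- Errors built from the operators `X(a)` only. -/
def IsQuditFlip {F : Type*} [Field F] {n : ℕ} (e : Fin n ⊕ Fin n → F[X]) : Prop :=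
  ∀ i, e (Sum.inr i) = 0

/-- The stabilizer matrix `S(D) = (X(D) | Z(D))` defines an asymmetric quantum convolutional code
with parameters `[(n, K, μ; γ, dz / dx)]`: frame size `n`, `K` logical qudits per frame, memory
`μ`, degree `γ`, and free distances `dz`, `dx` for phase-shift and qudit-flip errors. -/
structure IsAQCC {F : Type*} [Field F] {n : ℕ} {ι : Type*} [Fintype ι] [DecidableEq ι]
    (S : Matrix ι (Fin n ⊕ Fin n) F[X]) (K μ γ dz dx : ℕ) : Prop where
  /-- `S(D)` is a reduced basic matrix; in particular it has full rank. -/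
  reduced : IsReducedBasic S
  /-- `X(D) Z(1/D)ᵗ - Z(D) X(1/D)ᵗ = 0`. -/
  orthogonal : ∀ i j, symplecticPairing (S i) (S j) = 0
  /-- `S(D)` has `n - K` rows. -/
  rows : Fintype.card ι + K = n
  memory_eq : memory S = μ
  degree_eq : overallConstraintLength S = γ
  phase : IsLeast {w | ∃ e, IsUndetectable S e ∧ IsPhaseShift e ∧ pauliWeight e = w} dz
  flip : IsLeast {w | ∃ e, IsUndetectable S e ∧ IsQuditFlip e ∧ pauliWeight e = w} dx

end

end AQCC

/-!
The factors `wᵢ` come from Lagrange interpolation: `∑ᵢ wᵢ vᵢ f(ζᵢ)` is the coefficient of `f` at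
`x ^ (n - 1)` whenever `deg f < n`. Hence the vectors `h_j = (wᵢ ζᵢ ^ j)ᵢ` with `j < m = n - k` are
the rows of a parity check matrix of `GRS_k(ζ, v)`. For `j < n` they form a basis of `F ^ n`, a
Vandermonde matrix up to column factors; let `b₀, …, b_{n-1}` be the dual basis.

The splittings are as follows.
* `G₂` has the rows `h₀ + h_t D`, `h₁`, …, `h_{t-1}`.
* `G₁` has in addition the rows `h_{t+1} + h_{m-1} D`, `h_{t+2}`, …, `h_{m-2}`.
* `H₁` has the rows `b_m`, …, `b_{n-1}`, `b₀ - b_t D`, `b_{t+1} - b_{m-1} D`.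

In the coordinates of the dual basis, orthogonality of a polynomial word to the rows of `G₁` says
that some coordinates vanish and that those at `t` and `m - 1` are `-D` times those at `0` and
`t + 1`; these words are the combinations of the rows of `H₁` (`mem_code_splitDual_iff_inDual`).
All three matrices are splittings of constant matrices of full row rank. Such a splitting is basic,
and its leading row coefficients are distinct rows of the constant matrix, hence independent. By the
predictable degree property this makes the matrix reduced basic
(`isReducedBasic_of_linearIndependent`), and the argument passes to the block diagonal stabilizer
matrix, whose degree is `1 + 2 = 3`.

An undetectable phase-shift error is a nonzero word orthogonal to `G₂`. Either all its coefficient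
vectors are orthogonal to `h₀, …, h_t`, and one of them has weight at least `t + 2`, or its top
coefficient vector is orthogonal to `h₀, …, h_{t-1}`, thus of weight at least `t + 1`, and there is
another nonzero coefficient vector (`weight_of_orthogonal_splitFirst`). An undetectable qudit-flip
error is a nonzero word orthogonal to `H₁`, in particular to the constant words of `GRS_k(ζ, v)`, so
its nonzero coefficient vectors have weight at least `k + 1` (`weight_of_inDual`). Both kinds of
errors exist: the constant word `b_{t+1}`, and the row `h_{t+1} + h_{m-1} D` of `G₁`.
-/

namespace AQCC

variable {F : Type*} [Field F]

/-! ### Row-reduced matrices -/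

lemma exists_eq_mul_of_code_le {ι ι' κ : Type*} [Fintype ι] [Fintype ι'] [DecidableEq ι'] {G : Matrix ι κ F[X]}
    {G' : Matrix ι' κ F[X]} (h : code G' ≤ code G) : ∃ T : Matrix ι' ι F[X], G' = T * G := by
  have : ∀ i, ∃ c, Matrix.vecMul c G = G' i := fun i =>
    h ⟨Pi.single i 1, by simp [Matrix.row]⟩
  choose T hT using this
  refine ⟨Matrix.of T, ?_⟩
  ext i j : 1
  rw [← hT i]
  rfl

section RowReduced

variable {ι κ : Type*} [Fintype κ]

/-- The matrix of leading row coefficients: row `i` collects the coefficients of `D ^ νᵢ`, where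
`νᵢ` is the degree of row `i`. -/
noncomputable def leadingRowCoeff (G : Matrix ι κ F[X]) : Matrix ι κ F :=
  Matrix.of fun i j => (G i j).coeff (rowDegree G i)

lemma natDegree_le_rowDegree (G : Matrix ι κ F[X]) (i : ι) (j : κ) :
    (G i j).natDegree ≤ rowDegree G i :=
  Finset.le_sup (f := fun j => (G i j).natDegree) (Finset.mem_univ j)

variable [Fintype ι]

/-- The predictable degree property: if the leading row coefficients are independent, the top
terms of the summands in `u(D) G(D)` cannot cancel. -/
lemma exists_rowDegree_le_natDegree_vecMul {G : Matrix ι κ F[X]}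
    (hG : LinearIndependent F (leadingRowCoeff G).row) {u : ι → F[X]} {i₀ : ι} (h₀ : u i₀ ≠ 0) :
    ∃ j, rowDegree G i₀ ≤ (Matrix.vecMul u G j).natDegree := by
  classical
  set s : Finset ι := Finset.univ.filter fun i => u i ≠ 0
  have hmem : i₀ ∈ s := by simp [s, h₀]
  obtain ⟨i₁, hi₁, hmax⟩ :=
    s.exists_max_image (fun i => (u i).natDegree + rowDegree G i) ⟨i₀, hmem⟩
  set d := (u i₁).natDegree + rowDegree G i₁ with hd
  -- the coefficient of `D ^ d` in the product, written in terms of the leading rows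
  have hcoeff : ∀ j, (Matrix.vecMul u G j).coeff d =
      ∑ i, (u i).coeff (d - rowDegree G i) * leadingRowCoeff G i j := by
    intro j
    rw [Matrix.vecMul, dotProduct, finsetSum_coeff]
    refine Finset.sum_congr rfl fun i _ => ?_
    by_cases hi : u i = 0
    · simp [hi]
    · have hle : (u i).natDegree + rowDegree G i ≤ d := hmax i (by simp [s, hi])
      have := coeff_mul_add_eq_of_natDegree_le
        (show (u i).natDegree ≤ d - rowDegree G i by omega) (natDegree_le_rowDegree G i j)
      rwa [Nat.sub_add_cancel (by omega)] at this
  have hne : ∃ j, (Matrix.vecMul u G j).coeff d ≠ 0 := by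
    by_contra! hzero
    have := Fintype.linearIndependent_iff.1 hG (fun i => (u i).coeff (d - rowDegree G i))
      (by ext j; simpa [Matrix.row, Finset.sum_apply] using (hcoeff j).symm.trans (hzero j)) i₁
    simp only [hd, Nat.add_sub_cancel, coeff_natDegree, leadingCoeff_eq_zero] at this
    simp [s, this] at hi₁
  obtain ⟨j, hj⟩ := hne
  have h₁ : (u i₀).natDegree + rowDegree G i₀ ≤ d := hmax i₀ hmem
  have h₂ := le_natDegree_of_ne_zero hj
  exact ⟨j, by omega⟩

variable [DecidableEq ι]

/-- A basic matrix with independent leading row coefficients is reduced. Another basic generator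
matrix is `T G` with `det T ≠ 0`, so some permutation picks nonzero entries of `T`, and by the
predictable degree property it matches the rows of `G` with rows of `T G` of at least the same
degree. -/
theorem isReducedBasic_of_linearIndependent {G : Matrix ι κ F[X]} (hb : IsBasic G)
    (hG : LinearIndependent F (leadingRowCoeff G).row) : IsReducedBasic G := by
  refine ⟨hb, fun G' _ hcode => ?_⟩
  obtain ⟨T, hT⟩ := exists_eq_mul_of_code_le hcode.le
  obtain ⟨T', hT'⟩ := exists_eq_mul_of_code_le hcode.ge
  obtain ⟨R, hR⟩ := hb
  have hTT : T' * T = 1 := by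
    calc T' * T = T' * T * (G * R) := by rw [hR, Matrix.mul_one]
      _ = T' * (T * G) * R := by simp only [Matrix.mul_assoc]
      _ = 1 := by rw [← hT, ← hT', hR]
  have hdet : T.det ≠ 0 := by
    intro h
    have := congrArg Matrix.det hTT
    simp [h] at this
  obtain ⟨π, hπ⟩ : ∃ π : Equiv.Perm ι, ∀ i, T (π i) i ≠ 0 := by
    by_contra! hall
    refine hdet ?_
    rw [Matrix.det_apply]
    refine Finset.sum_eq_zero fun π _ => ?_
    obtain ⟨i, hi⟩ := hall π
    have hprod : ∏ i, T (π i) i = 0 := Finset.prod_eq_zero (Finset.mem_univ i) hi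
    exact (congrArg _ hprod).trans (smul_zero _)
  calc overallConstraintLength G ≤ ∑ i, rowDegree G' (π i) := by
        refine Finset.sum_le_sum fun i _ => ?_
        obtain ⟨j, hj⟩ := exists_rowDegree_le_natDegree_vecMul hG (hπ i)
        refine hj.trans ?_
        have : Matrix.vecMul (T (π i)) G j = G' (π i) j := by rw [hT]; rfl
        rw [this]
        exact natDegree_le_rowDegree G' _ _
    _ = overallConstraintLength G' := Equiv.sum_comp π (rowDegree G')

end RowReduced

lemma linearIndependent_row_fromBlocks {ι₁ ι₂ κ₁ κ₂ : Type*} [Fintype ι₁] [Fintype ι₂]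
    {A : Matrix ι₁ κ₁ F} {B : Matrix ι₂ κ₂ F}
    (hA : LinearIndependent F A.row) (hB : LinearIndependent F B.row) :
    LinearIndependent F (Matrix.fromBlocks A 0 0 B).row := by
  rw [Fintype.linearIndependent_iff] at hA hB ⊢
  intro g hg
  have h₁ := hA (fun i => g (Sum.inl i)) (by
    ext j; simpa [Finset.sum_apply, Matrix.row] using congrFun hg (Sum.inl j))
  have h₂ := hB (fun i => g (Sum.inr i)) (by
    ext j; simpa [Finset.sum_apply, Matrix.row] using congrFun hg (Sum.inr j))
  rintro (i | i)
  · exact h₁ i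
  · exact h₂ i

lemma IsBasic.fromBlocks {ι₁ ι₂ κ₁ κ₂ : Type*} [Fintype κ₁] [Fintype κ₂] [DecidableEq ι₁] [DecidableEq ι₂] {G : Matrix ι₁ κ₁ F[X]}
    {H : Matrix ι₂ κ₂ F[X]} (hG : IsBasic G) (hH : IsBasic H) :
    IsBasic (Matrix.fromBlocks G 0 0 H) := by
  obtain ⟨R, hR⟩ := hG
  obtain ⟨Q, hQ⟩ := hH
  exact ⟨Matrix.fromBlocks R 0 0 Q, by
    simp [Matrix.fromBlocks_multiply, hR, hQ]⟩

section Blocks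

variable {ι₁ ι₂ κ₁ κ₂ : Type*} [Fintype κ₁] [Fintype κ₂]

lemma rowDegree_fromBlocks_inl (G : Matrix ι₁ κ₁ F[X]) (H : Matrix ι₂ κ₂ F[X]) (i : ι₁) :
    rowDegree (Matrix.fromBlocks G 0 0 H) (Sum.inl i) = rowDegree G i := by
  apply le_antisymm
  · refine Finset.sup_le fun j _ => ?_
    cases j with
    | inl j => exact natDegree_le_rowDegree G i j
    | inr j => simp
  · exact Finset.sup_le fun j _ =>
      natDegree_le_rowDegree (Matrix.fromBlocks G 0 0 H) (Sum.inl i) (Sum.inl j)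

lemma rowDegree_fromBlocks_inr (G : Matrix ι₁ κ₁ F[X]) (H : Matrix ι₂ κ₂ F[X]) (i : ι₂) :
    rowDegree (Matrix.fromBlocks G 0 0 H) (Sum.inr i) = rowDegree H i := by
  apply le_antisymm
  · refine Finset.sup_le fun j _ => ?_
    cases j with
    | inl j => simp
    | inr j => exact natDegree_le_rowDegree H i j
  · exact Finset.sup_le fun j _ =>
      natDegree_le_rowDegree (Matrix.fromBlocks G 0 0 H) (Sum.inr i) (Sum.inr j)

lemma leadingRowCoeff_fromBlocks (G : Matrix ι₁ κ₁ F[X]) (H : Matrix ι₂ κ₂ F[X]) :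
    leadingRowCoeff (Matrix.fromBlocks G 0 0 H) =
      Matrix.fromBlocks (leadingRowCoeff G) 0 0 (leadingRowCoeff H) := by
  ext i j
  cases i <;> cases j <;>
    simp [leadingRowCoeff, rowDegree_fromBlocks_inl, rowDegree_fromBlocks_inr]

variable [Fintype ι₁] [Fintype ι₂]

lemma overallConstraintLength_fromBlocks (G : Matrix ι₁ κ₁ F[X]) (H : Matrix ι₂ κ₂ F[X]) :
    overallConstraintLength (Matrix.fromBlocks G 0 0 H) =
      overallConstraintLength G + overallConstraintLength H := by
  simp [overallConstraintLength, rowDegree_fromBlocks_inl, rowDegree_fromBlocks_inr]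

end Blocks

/-! ### Splittings -/

/-- The polynomial matrix obtained by moving row `j` of `H` to row `(σ j).1` of the coefficient
of `D ^ (σ j).2`. -/
noncomputable def splitMatrix {ι κ ι' : Type*} [Fintype ι] [DecidableEq ι'] (H : Matrix ι κ F)
    (σ : ι → ι' × ℕ) : Matrix ι' κ F[X] :=
  Matrix.of fun a b => ∑ j, if (σ j).1 = a then monomial (σ j).2 (H j b) else 0

lemma coeff_splitMatrix {ι κ ι' : Type*} [Fintype ι] [DecidableEq ι'] {H : Matrix ι κ F}
    {σ : ι → ι' × ℕ} (hσ : Function.Injective σ) {j : ι} {a : ι'} {d : ℕ} (hj : σ j = (a, d))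
    (b : κ) : (splitMatrix H σ a b).coeff d = H j b := by
  rw [splitMatrix, Matrix.of_apply, finsetSum_coeff, Finset.sum_eq_single j]
  · simp [hj]
  · intro j' _ hne
    split_ifs with h
    · rw [coeff_monomial, if_neg]
      rintro rfl
      exact hne (hσ (by rw [hj, ← h]))
    · simp
  · simp

section Split

variable {ι κ ι' : Type*} [Fintype ι] [Fintype κ] [DecidableEq ι] [DecidableEq ι']
  {H : Matrix ι κ F} {σ : ι → ι' × ℕ} {R : Matrix κ ι F}

lemma linearIndependent_row_of_mul_eq_one (hR : H * R = 1) : LinearIndependent F H.row := by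
  rw [← Matrix.vecMul_injective_iff]
  intro x y hxy
  have := congrArg (fun z => Matrix.vecMul z R) hxy
  simpa [Matrix.vecMul_vecMul, hR] using this

/-- In a splitting of independent rows, the degree of a row is the largest shift used in it. -/
lemma rowDegree_splitMatrix (hR : H * R = 1) (hσ : Function.Injective σ) {d : ι' → ℕ}
    (hd : ∀ a, ∃ j, σ j = (a, d a)) (hle : ∀ j, (σ j).2 ≤ d (σ j).1) (a : ι') :
    rowDegree (splitMatrix H σ) a = d a := by
  apply le_antisymm
  · refine Finset.sup_le fun b _ => natDegree_sum_le_of_forall_le _ _ fun j _ => ?_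
    split_ifs with h
    · exact (natDegree_monomial_le _).trans (h ▸ hle j)
    · simp
  · obtain ⟨j, hj⟩ := hd a
    have hne : H j ≠ 0 := (linearIndependent_row_of_mul_eq_one hR).ne_zero j
    obtain ⟨b, hb⟩ := Function.ne_iff.1 hne
    refine (le_natDegree_of_ne_zero ?_).trans (natDegree_le_rowDegree (splitMatrix H σ) a b)
    rwa [coeff_splitMatrix hσ hj]

/-- A splitting in which the constant coefficient has no zero row is basic: it is a product
`P(D) H`, where columns of `P(D)` that belong to rows of shift zero form an identity matrix. -/
lemma isBasic_splitMatrix [Fintype ι'] (hR : H * R = 1)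
    (h₀ : ∀ a, ∃ j, σ j = (a, 0)) : IsBasic (splitMatrix H σ) := by
  choose p hp using h₀
  refine ⟨Matrix.of fun b a => C (R b (p a)), ?_⟩
  ext a a' : 1
  have hone : ∀ j, ∑ b, H j b * R b (p a') = if j = p a' then 1 else 0 := fun j => by
    simpa [Matrix.mul_apply, Matrix.one_apply] using congrFun (congrFun hR j) (p a')
  have : (splitMatrix H σ * Matrix.of fun b a => C (R b (p a))) a a' =
      ∑ j, if (σ j).1 = a then monomial (σ j).2 (∑ b, H j b * R b (p a')) else 0 := by
    simp only [Matrix.mul_apply, splitMatrix, Matrix.of_apply, Finset.sum_mul]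
    rw [Finset.sum_comm]
    refine Finset.sum_congr rfl fun j _ => ?_
    split_ifs
    · simp [monomial_mul_C]
    · simp
  rw [this, Finset.sum_eq_single (p a')]
  · rw [hone, if_pos rfl, hp]
    simp [Matrix.one_apply, eq_comm]
  · intro j _ hj
    simp [hone, hj]
  · simp

lemma linearIndependent_leadingRowCoeff_splitMatrix (hR : H * R = 1) (hσ : Function.Injective σ)
    {d : ι' → ℕ} (hd : ∀ a, ∃ j, σ j = (a, d a)) (hle : ∀ j, (σ j).2 ≤ d (σ j).1) :
    LinearIndependent F (leadingRowCoeff (splitMatrix H σ)).row := by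
  choose p hp using hd
  have hinj : Function.Injective p := fun a a' h => by
    have := hp a
    rw [h, hp a'] at this
    exact (Prod.ext_iff.1 this).1.symm
  convert (linearIndependent_row_of_mul_eq_one hR).comp p hinj using 1
  ext a b
  simp only [Matrix.row, leadingRowCoeff, Matrix.of_apply, Function.comp]
  rw [rowDegree_splitMatrix hR hσ (fun a => ⟨p a, hp a⟩) hle, coeff_splitMatrix hσ (hp a)]

end Split

/-! ### Duals of split matrices -/

section Duality

variable {n : ℕ}

lemma conjPairing_comm (u v : Fin n → F[X]) :
    conjPairing v u = LaurentPolynomial.invert (conjPairing u v) := by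
  simp only [conjPairing, map_sum, map_mul]
  refine Finset.sum_congr rfl fun i _ => ?_
  rw [LaurentPolynomial.involutive_invert, mul_comm]

lemma conjPairing_eq_zero_comm {u v : Fin n → F[X]} :
    conjPairing u v = 0 ↔ conjPairing v u = 0 := by
  rw [conjPairing_comm v u]
  simp

@[simp] lemma conjPairing_zero_left (v : Fin n → F[X]) : conjPairing (fun _ => 0) v = 0 := by
  simp [conjPairing]

@[simp] lemma conjPairing_zero_right (u : Fin n → F[X]) : conjPairing u (fun _ => 0) = 0 := by
  simp [conjPairing]

lemma inDual_code_iff {ι : Type*} [Fintype ι] {G : Matrix ι (Fin n) F[X]} {u : Fin n → F[X]} :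
    InDual (code G) u ↔ ∀ a, conjPairing u (G a) = 0 := by
  classical
  constructor
  · exact fun h a => h _ ⟨Pi.single a 1, by simp [Matrix.row]⟩
  · rintro h _ ⟨c, rfl⟩
    have : conjPairing u (Matrix.vecMul c G) =
        ∑ a, LaurentPolynomial.invert (toLaurent (c a)) * conjPairing u (G a) := by
      simp only [conjPairing, Matrix.vecMul, dotProduct, map_sum, map_mul, Finset.mul_sum]
      rw [Finset.sum_comm]
      exact Finset.sum_congr rfl fun a _ => Finset.sum_congr rfl fun i _ => by ring
    simpa [h] using this

/-- The product of a constant matrix with a polynomial word: the coefficients of `syndrome A u` are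
the syndromes with respect to `A` of the coefficient vectors of `u`. -/
noncomputable def syndrome {ι : Type*} (A : Matrix ι (Fin n) F) (u : Fin n → F[X]) (j : ι) :
    F[X] :=
  ∑ i, C (A j i) * u i

section

variable {ι ι' : Type*} [Fintype ι] [DecidableEq ι'] {H : Matrix ι (Fin n) F} {σ : ι → ι' × ℕ}

lemma conjPairing_splitMatrix (u : Fin n → F[X]) (a : ι') :
    conjPairing u (splitMatrix H σ a) = ∑ j, if (σ j).1 = a then
      LaurentPolynomial.T (-((σ j).2 : ℤ)) * toLaurent (syndrome H u j) else 0 := by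
  simp only [conjPairing, splitMatrix, Matrix.of_apply, map_sum, Finset.mul_sum]
  rw [Finset.sum_comm]
  refine Finset.sum_congr rfl fun j _ => ?_
  split_ifs
  · simp only [syndrome, map_sum, Finset.mul_sum, toLaurent_C_mul_T, map_mul, toLaurent_C,
      LaurentPolynomial.invert_T, LaurentPolynomial.invert_C]
    exact Finset.sum_congr rfl fun i _ => by ring
  · simp

lemma conjPairing_splitMatrix_eq_zero_iff_of_single {u : Fin n → F[X]} {a : ι'} {p : ι}
    (hp : ∀ j, (σ j).1 = a ↔ j = p) :
    conjPairing u (splitMatrix H σ a) = 0 ↔ syndrome H u p = 0 := by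
  classical
  rw [conjPairing_splitMatrix]
  simp only [hp, Finset.sum_ite_eq', Finset.mem_univ, if_true]
  rw [(LaurentPolynomial.isUnit_T _).mul_right_eq_zero, toLaurent_eq_zero]

lemma conjPairing_splitMatrix_eq_zero_iff_of_pair {u : Fin n → F[X]} {a : ι'} {p p' : ι}
    (hp : ∀ j, (σ j).1 = a ↔ j = p ∨ j = p') (h₀ : (σ p).2 = 0) (h₁ : (σ p').2 = 1) :
    conjPairing u (splitMatrix H σ a) = 0 ↔ syndrome H u p' = -X * syndrome H u p := by
  classical
  have hne : p ≠ p' := by rintro rfl; omega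
  rw [conjPairing_splitMatrix, ← Finset.sum_filter]
  have : (Finset.univ.filter fun j => (σ j).1 = a) = {p, p'} := by
    ext j; simp [hp]
  rw [this, Finset.sum_pair hne, h₀, h₁,
    ← (LaurentPolynomial.isUnit_T (R := F) 1).mul_right_eq_zero, mul_add, ← mul_assoc, ← mul_assoc,
    ← LaurentPolynomial.T_add, ← LaurentPolynomial.T_add]
  have hT : (LaurentPolynomial.T 1 : F[T;T⁻¹]) = toLaurent X := toLaurent_X.symm
  simp only [Nat.cast_zero, neg_zero, add_zero, Nat.cast_one, add_neg_cancel,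
    LaurentPolynomial.T_zero, one_mul]
  rw [hT, ← map_mul, ← map_add, toLaurent_eq_zero, add_comm, add_eq_zero_iff_eq_neg, neg_mul]

lemma syndrome_vecMul_splitMatrix [Fintype ι'] (B : Matrix (Fin n) (Fin n) F) (c : ι' → F[X]) (j : Fin n) :
    syndrome B (Matrix.vecMul c (splitMatrix H σ)) j =
      ∑ p, c (σ p).1 * monomial (σ p).2 (∑ i, B j i * H p i) := by
  have h : ∀ i, Matrix.vecMul c (splitMatrix H σ) i =
      ∑ p, c (σ p).1 * monomial (σ p).2 (H p i) := by
    intro i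
    simp only [Matrix.vecMul, dotProduct, splitMatrix, Matrix.of_apply, Finset.mul_sum]
    rw [Finset.sum_comm]
    simp
  simp only [syndrome, h, Finset.mul_sum, map_sum]
  rw [Finset.sum_comm]
  refine Finset.sum_congr rfl fun p _ => Finset.sum_congr rfl fun i _ => ?_
  rw [← C_mul_monomial]
  ring

end

lemma syndrome_injective {A M : Matrix (Fin n) (Fin n) F} (hM : M * A = 1) :
    Function.Injective (syndrome A) := by
  intro u u' h
  have key : ∀ (u : Fin n → F[X]) (i : Fin n), u i = ∑ j, C (M i j) * syndrome A u j := by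
    intro u i
    have h₁ : ∀ l, ∑ j, M i j * A j l = if i = l then 1 else 0 := fun l => by
      simpa [Matrix.mul_apply, Matrix.one_apply] using congrFun (congrFun hM i) l
    simp only [syndrome, Finset.mul_sum]
    rw [Finset.sum_comm]
    have h₂ : ∀ l, ∑ j, C (M i j) * (C (A j l) * u l) = C (if i = l then 1 else 0) * u l := by
      intro l
      rw [← h₁ l, map_sum, Finset.sum_mul]
      exact Finset.sum_congr rfl fun j _ => by rw [map_mul, mul_assoc]
    simp [h₂, apply_ite C]
  funext i
  rw [key u i, key u' i, h]

section

variable {ι ι' : Type*} {A M : Matrix (Fin n) (Fin n) F}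

/-- Rows of the basis dual to the rows of `M⁻¹`, selected by `τ`; the row shifted by `D ^ s` gets
the sign `(-1) ^ s`, so that a split pair of rows is orthogonal to a split pair of rows of `M⁻¹`. -/
def signedDualRows (M : Matrix (Fin n) (Fin n) F) (τ : ι → Fin n) (σ : ι → ι' × ℕ) :
    Matrix ι (Fin n) F :=
  Matrix.of fun p i => (-1) ^ (σ p).2 * M i (τ p)

lemma sum_mul_signedDualRows (hA : A * M = 1) (τ : ι → Fin n) (σ : ι → ι' × ℕ)
    (j : Fin n) (p : ι) :
    ∑ i, A j i * signedDualRows M τ σ p i = if j = τ p then (-1) ^ (σ p).2 else 0 := by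
  have h : ∑ i, A j i * M i (τ p) = if j = τ p then 1 else 0 := by
    simpa [Matrix.mul_apply, Matrix.one_apply] using congrFun (congrFun hA j) (τ p)
  have h' : ∀ i, A j i * signedDualRows M τ σ p i = (-1) ^ (σ p).2 * (A j i * M i (τ p)) :=
    fun i => by simp only [signedDualRows, Matrix.of_apply]; ring
  simp only [h', ← Finset.mul_sum, h]
  simp

lemma exists_signedDualRows_mul_eq_one [DecidableEq ι] (hA : A * M = 1)
    {τ : ι → Fin n} (hτ : Function.Injective τ) (σ : ι → ι' × ℕ) :
    ∃ R : Matrix (Fin n) ι F, signedDualRows M τ σ * R = 1 := by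
  refine ⟨Matrix.of fun i p => (-1) ^ (σ p).2 * A (τ p) i, ?_⟩
  ext p p'
  have : (signedDualRows M τ σ * Matrix.of fun i p => (-1) ^ (σ p).2 * A (τ p) i) p p' =
      (-1) ^ (σ p').2 * ∑ i, A (τ p') i * signedDualRows M τ σ p i := by
    simp only [Matrix.mul_apply, Matrix.of_apply, Finset.mul_sum]
    exact Finset.sum_congr rfl fun i _ => by ring
  rw [this, sum_mul_signedDualRows hA, Matrix.one_apply]
  by_cases h : p = p'
  · subst h
    simp [← mul_pow]
  · rw [if_neg (fun h' => h (hτ h').symm), if_neg h, mul_zero]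

lemma mem_code_splitMatrix_signedDualRows [Fintype ι] [Fintype ι'] [DecidableEq ι']
    (hA : A * M = 1) {τ : ι → Fin n}
    (hτ : Function.Injective τ) (σ : ι → ι' × ℕ) {u : Fin n → F[X]} :
    u ∈ code (splitMatrix (signedDualRows M τ σ) σ) ↔
      ∃ c : ι' → F[X], (∀ p, syndrome A u (τ p) = (-X) ^ (σ p).2 * c (σ p).1) ∧
        ∀ j, j ∉ Set.range τ → syndrome A u j = 0 := by
  have hs : ∀ c j, syndrome A (Matrix.vecMul c (splitMatrix (signedDualRows M τ σ) σ)) j =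
      ∑ p, if j = τ p then (-X) ^ (σ p).2 * c (σ p).1 else 0 := by
    intro c j
    rw [syndrome_vecMul_splitMatrix]
    refine Finset.sum_congr rfl fun p _ => ?_
    rw [sum_mul_signedDualRows hA]
    split_ifs
    · rw [← C_mul_X_pow_eq_monomial, neg_pow (X : F[X])]
      simp
      ring
    · simp
  have hs₁ : ∀ c p, syndrome A (Matrix.vecMul c (splitMatrix (signedDualRows M τ σ) σ)) (τ p) =
      (-X) ^ (σ p).2 * c (σ p).1 := by
    intro c p
    rw [hs, Finset.sum_eq_single p]
    · simp
    · exact fun p' _ hp' => if_neg fun h => hp' (hτ h).symm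
    · simp
  have hs₂ : ∀ c j, j ∉ Set.range τ →
      syndrome A (Matrix.vecMul c (splitMatrix (signedDualRows M τ σ) σ)) j = 0 := by
    intro c j hj
    rw [hs]
    exact Finset.sum_eq_zero fun p _ => if_neg fun h => hj ⟨p, h.symm⟩
  constructor
  · rintro ⟨c, rfl⟩
    exact ⟨c, hs₁ c, hs₂ c⟩
  · rintro ⟨c, h₁, h₂⟩
    refine ⟨c, syndrome_injective (mul_eq_one_comm.1 hA) (funext fun j => ?_)⟩
    change syndrome A (Matrix.vecMul c _) j = _
    by_cases hj : j ∈ Set.range τ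
    · obtain ⟨p, rfl⟩ := hj
      rw [hs₁, h₁]
    · rw [hs₂ c j hj, h₂ j hj]

end

end Duality

/-! ### Generalized Reed–Solomon codes -/

section GRS

variable {n : ℕ} {ζ : Fin n → F}

lemma mem_GRS_iff {k : ℕ} {v c : Fin n → F} :
    c ∈ GRS k ζ v ↔ ∃ f : F[X], f.degree < k ∧ ∀ i, c i = v i * f.eval (ζ i) := by
  simp only [GRS, Submodule.mem_map, mem_degreeLT, funext_iff]
  simp [eq_comm]

/-- The factors `wᵢ` for which the code `GRS_{n-k}(ζ, w)` is dual to `GRS_k(ζ, v)`. -/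
noncomputable def dualWeight (ζ v : Fin n → F) (i : Fin n) : F :=
  (v i)⁻¹ * Lagrange.nodalWeight Finset.univ ζ i

lemma dualWeight_ne_zero (hζ : Function.Injective ζ) {v : Fin n → F} (hv : ∀ i, v i ≠ 0)
    (i : Fin n) : dualWeight ζ v i ≠ 0 :=
  mul_ne_zero (inv_ne_zero (hv i))
    (Lagrange.nodalWeight_ne_zero hζ.injOn (Finset.mem_univ i))

/-- Lagrange interpolation computes the coefficient at `x ^ (n - 1)`. -/
lemma sum_dualWeight_mul_eval (hζ : Function.Injective ζ) {v : Fin n → F} (hv : ∀ i, v i ≠ 0)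
    {f : F[X]} (hf : f.degree < n) :
    ∑ i, dualWeight ζ v i * (v i * f.eval (ζ i)) = f.coeff (n - 1) := by
  have h := Lagrange.coeff_eq_sum (s := Finset.univ) (v := ζ) hζ.injOn (P := f) (by simpa using hf)
  rw [Finset.card_univ, Fintype.card_fin] at h
  rw [h]
  refine Finset.sum_congr rfl fun i _ => ?_
  rw [dualWeight, Lagrange.nodalWeight, Finset.prod_inv_distrib, div_eq_mul_inv]
  have := hv i
  field_simp

/-- The square matrix with rows `(wᵢ ζᵢ ^ j)ᵢ` is a Vandermonde matrix up to column factors. -/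
lemma exists_grsMatrix_mul_eq_one (hζ : Function.Injective ζ) {w : Fin n → F}
    (hw : ∀ i, w i ≠ 0) : ∃ M : Matrix (Fin n) (Fin n) F, grsMatrix n ζ w * M = 1 := by
  have h : grsMatrix n ζ w = (Matrix.vandermonde ζ).transpose * Matrix.diagonal w := by
    ext j i
    simp [grsMatrix, Matrix.vandermonde_apply, mul_comm]
  refine ⟨(grsMatrix n ζ w)⁻¹, Matrix.mul_nonsing_inv _ ?_⟩
  rw [h, Matrix.det_mul, Matrix.det_transpose, Matrix.det_diagonal]
  exact (mul_ne_zero (Matrix.det_vandermonde_ne_zero_iff.2 hζ)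
    (Finset.prod_ne_zero_iff.2 fun i _ => hw i)).isUnit

lemma exists_grsMatrix_mul_eq_one_of_le (hζ : Function.Injective ζ) {w : Fin n → F}
    (hw : ∀ i, w i ≠ 0) {m : ℕ} (hm : m ≤ n) : ∃ R : Matrix (Fin n) (Fin m) F, grsMatrix m ζ w * R = 1 := by
  obtain ⟨M, hM⟩ := exists_grsMatrix_mul_eq_one hζ hw
  refine ⟨M.submatrix id (Fin.castLE hm), ?_⟩
  have := congrArg (fun N => N.submatrix (Fin.castLE hm) (Fin.castLE hm)) hM
  simp only [Matrix.submatrix_one _ (Fin.castLE_injective hm)] at this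
  rw [← this]
  rfl

theorem isParityCheckMatrix_grsMatrix (hζ : Function.Injective ζ) {v : Fin n → F}
    (hv : ∀ i, v i ≠ 0) {k : ℕ} (hk : k ≤ n) :
    IsParityCheckMatrix (grsMatrix (n - k) ζ (dualWeight ζ v)) (GRS k ζ v) := by
  obtain ⟨R, hR⟩ := exists_grsMatrix_mul_eq_one_of_le hζ (dualWeight_ne_zero hζ hv)
    (Nat.sub_le n k)
  refine ⟨linearIndependent_row_of_mul_eq_one hR, fun c => ?_⟩
  -- the polynomial `f` of degree less than `n` with `cᵢ = vᵢ f(ζᵢ)`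
  set f := Lagrange.interpolate Finset.univ ζ fun i => (v i)⁻¹ * c i with hf
  have hfdeg : f.degree < n := by
    have := Lagrange.degree_interpolate_lt (s := Finset.univ) (fun i => (v i)⁻¹ * c i) hζ.injOn
    rwa [Finset.card_univ, Fintype.card_fin] at this
  have hfc : ∀ i, c i = v i * f.eval (ζ i) := fun i => by
    rw [hf, Lagrange.eval_interpolate_at_node _ hζ.injOn (Finset.mem_univ i),
      mul_inv_cancel_left₀ (hv i)]
  have hsum : ∀ (g : F[X]) (j : Fin (n - k)), (∀ i, c i = v i * g.eval (ζ i)) →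
      (grsMatrix (n - k) ζ (dualWeight ζ v)).mulVec c j =
        ∑ i, dualWeight ζ v i * (v i * (X ^ (j : ℕ) * g).eval (ζ i)) := fun g j hg => by
    simp only [Matrix.mulVec, dotProduct, grsMatrix, Matrix.of_apply, eval_mul, eval_pow, eval_X]
    exact Finset.sum_congr rfl fun i _ => by rw [hg i]; ring
  rw [mem_GRS_iff]
  constructor
  · rintro ⟨g, hg, hgc⟩
    funext j
    have hj := j.2
    have hlt : (X ^ (j : ℕ) * g).degree < ((n - 1 : ℕ) : WithBot ℕ) := by
      rcases eq_or_ne g 0 with rfl | hg0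
      · simp
      rw [degree_mul, degree_X_pow, degree_eq_natDegree hg0]
      rw [degree_eq_natDegree hg0] at hg
      have : g.natDegree < k := by exact_mod_cast hg
      exact_mod_cast (by omega : (j : ℕ) + g.natDegree < n - 1)
    rw [hsum g j hgc, sum_dualWeight_mul_eval hζ hv, coeff_eq_zero_of_degree_lt hlt]
    · rfl
    · exact hlt.trans_le (by exact_mod_cast Nat.sub_le n 1)
  · intro h
    refine ⟨f, ?_, hfc⟩
    by_contra! hdeg
    -- multiplied by a power of `x`, `f` gets degree `n - 1`, and the sum is its leading coefficient
    have hf0 : f ≠ 0 := by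
      rintro h0
      simp [h0] at hdeg
    rw [degree_eq_natDegree hf0] at hfdeg hdeg
    have h₁ : f.natDegree < n := by exact_mod_cast hfdeg
    have h₂ : k ≤ f.natDegree := by exact_mod_cast hdeg
    have h₃ := congrFun h ⟨n - 1 - f.natDegree, by omega⟩
    rw [hsum f _ hfc, sum_dualWeight_mul_eval hζ hv] at h₃
    · rw [coeff_X_pow_mul', if_pos (by simp)] at h₃
      simp only [Pi.zero_apply] at h₃
      rw [show n - 1 - (n - 1 - f.natDegree) = f.natDegree by omega] at h₃
      exact hf0 (leadingCoeff_eq_zero.1 h₃)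
    · rw [degree_mul, degree_X_pow, degree_eq_natDegree hf0]
      exact_mod_cast (by omega : n - 1 - f.natDegree + f.natDegree < n)

/-- The minimum distance bound: a nonzero word orthogonal to `GRS_d(ζ, w)` has weight greater than
`d`, since otherwise some `f` of degree less than `d` vanishes at all but one of the nodes of its
support. -/
lemma lt_hammingNorm_of_orthogonal [DecidableEq F] (hζ : Function.Injective ζ) {w : Fin n → F}
    (hw : ∀ i, w i ≠ 0) {d : ℕ} {x : Fin n → F} (hx : x ≠ 0)
    (h : ∀ f : F[X], f.degree < d → ∑ i, w i * f.eval (ζ i) * x i = 0) :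
    d < hammingNorm x := by
  by_contra! hle
  obtain ⟨i₀, hi₀⟩ := Function.ne_iff.1 hx
  simp only [Pi.zero_apply] at hi₀
  set s : Finset (Fin n) := Finset.univ.filter fun i => x i ≠ 0
  have hmem : i₀ ∈ s := by simp [s, hi₀]
  set f : F[X] := Lagrange.nodal (s.erase i₀) ζ with hf
  have hcard : (s.erase i₀).card < s.card := Finset.card_erase_lt_of_mem hmem
  have h₀ := h f (by
    rw [hf, Lagrange.degree_nodal]
    have : (s.erase i₀).card < d := by convert hcard.trans_le hle
    exact_mod_cast this)
  rw [Finset.sum_eq_single i₀] at h₀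
  · refine mul_ne_zero (mul_ne_zero (hw i₀) ?_) hi₀ h₀
    rw [hf, Lagrange.eval_nodal, Finset.prod_ne_zero_iff]
    intro i hi
    exact sub_ne_zero.2 fun h => (Finset.ne_of_mem_erase hi) (hζ h).symm
  · intro i _ hne
    by_cases hi : x i = 0
    · rw [hi, mul_zero]
    · rw [hf, Lagrange.eval_nodal_at_node (Finset.mem_erase.2 ⟨hne, by simp [s, hi]⟩)]
      ring
  · simp

lemma lt_hammingNorm_of_syndromes [DecidableEq F] (hζ : Function.Injective ζ) {w : Fin n → F}
    (hw : ∀ i, w i ≠ 0) {d : ℕ} {x : Fin n → F} (hx : x ≠ 0)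
    (h : ∀ j < d, ∑ i, w i * ζ i ^ j * x i = 0) :
    d < hammingNorm x := by
  refine lt_hammingNorm_of_orthogonal hζ hw hx fun f hf => ?_
  simp only [eval_eq_sum, sum_def, Finset.mul_sum, Finset.sum_mul]
  rw [Finset.sum_comm]
  refine Finset.sum_eq_zero fun j hj => ?_
  have hjd : j < d := by
    have := (le_degree_of_mem_supp j hj).trans_lt hf
    exact_mod_cast this
  rw [← mul_zero (f.coeff j), ← h j hjd, Finset.mul_sum]
  exact Finset.sum_congr rfl fun i _ => by ring

/-- The weight of a polynomial word is at least the sum of the weights of any of its coefficient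
vectors. -/
lemma sum_hammingNorm_coeff_le [DecidableEq F] (u : Fin n → F[X]) (S : Finset ℕ) :
    ∑ s ∈ S, (hammingNorm fun i => (u i).coeff s) ≤
      ∑ i, (u i).support.card := by
  simp only [hammingNorm, Finset.card_filter]
  rw [Finset.sum_comm]
  refine Finset.sum_le_sum fun i _ => ?_
  rw [← Finset.card_filter]
  exact Finset.card_le_card fun s hs => mem_support_iff.2 (by simpa using (Finset.mem_filter.1 hs).2)

end GRS

/-! ### The three splittings -/

section Splittings

/-- The splitting into `t` rows of the first `t + 1` rows of a matrix with rows `h₀, h₁, …`: row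
`0` becomes `h₀ + h_t D` and the other rows stay constant. -/
def splitFirst {t : ℕ} (ht : 0 < t) (j : Fin (t + 1)) : Fin t × ℕ :=
  if h : (j : ℕ) < t then (⟨j, h⟩, 0) else (⟨0, ht⟩, 1)

/-- The splitting of rows `h₀, …, h_{m-1}` into `m - 2` rows that extends `splitFirst`: row `0`
becomes `h₀ + h_t D`, row `t` becomes `h_{t+1} + h_{m-1} D`, the other rows stay constant. -/
def splitAll {t m : ℕ} (ht : 0 < t) (htm : t + 3 ≤ m) (j : Fin m) : Fin (m - 2) × ℕ :=
  if h : (j : ℕ) < t then (⟨j, by omega⟩, 0)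
  else if h' : (j : ℕ) = t then (⟨0, by omega⟩, 1)
  else if h'' : (j : ℕ) + 1 = m then (⟨t, by omega⟩, 1)
  else (⟨j - 1, by omega⟩, 0)

/-- The splitting of `k + 4` rows into `k + 2` rows that moves the last two rows below the rows
`k` and `k + 1`. -/
def splitDual {k : ℕ} (j : Fin (k + 4)) : Fin (k + 2) × ℕ :=
  if h : (j : ℕ) < k + 2 then (⟨j, h⟩, 0) else (⟨j - 2, by omega⟩, 1)

/-- The rows of the dual basis that enter the generator matrix of the dual code of `splitAll`:
those of index at least `m`, which span the words orthogonal to `h₀, …, h_{m-1}`, and the pairs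
of indices `(0, t)` and `(t + 1, m - 1)`. -/
def dualRowIndex {n k m t : ℕ} (hm : m + k = n) (htm : t + 3 ≤ m) (j : Fin (k + 4)) : Fin n :=
  if h : (j : ℕ) < k then ⟨m + j, by omega⟩
  else if (j : ℕ) = k then ⟨0, by omega⟩
  else if (j : ℕ) = k + 1 then ⟨t + 1, by omega⟩
  else if (j : ℕ) = k + 2 then ⟨t, by omega⟩
  else ⟨m - 1, by omega⟩

variable {n k m t : ℕ}

lemma splitFirst_injective (ht : 0 < t) : Function.Injective (splitFirst ht) := by
  intro i j h
  simp only [splitFirst] at h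
  ext
  split_ifs at h <;> (simp_all; try omega)

lemma splitAll_injective (ht : 0 < t) (htm : t + 3 ≤ m) :
    Function.Injective (splitAll ht htm) := by
  intro i j h
  simp only [splitAll] at h
  ext
  split_ifs at h <;> simp_all <;> omega

lemma splitDual_injective : Function.Injective (splitDual (k := k)) := by
  intro i j h
  simp only [splitDual] at h
  ext
  split_ifs at h <;> (simp_all; try omega)

lemma dualRowIndex_injective (ht : 0 < t) (hm : m + k = n) (htm : t + 3 ≤ m) :
    Function.Injective (dualRowIndex hm htm) := by
  intro i j h
  simp only [dualRowIndex] at h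
  ext
  split_ifs at h <;> simp only [Fin.mk.injEq] at h <;> omega

lemma exists_splitFirst_eq_zero (ht : 0 < t) (a : Fin t) : ∃ j, splitFirst ht j = (a, 0) :=
  ⟨a.castSucc, by simp [splitFirst]⟩

lemma exists_splitAll_eq_zero (ht : 0 < t) (htm : t + 3 ≤ m) (a : Fin (m - 2)) :
    ∃ j, splitAll ht htm j = (a, 0) := by
  by_cases h : (a : ℕ) < t
  · exact ⟨⟨a, by omega⟩, by simp [splitAll, h]⟩
  · refine ⟨⟨a + 1, by omega⟩, ?_⟩
    have h₁ : ¬ (a : ℕ) + 1 < t := by omega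
    have h₂ : ¬ (a : ℕ) + 1 = t := by omega
    have h₃ : ¬ (a : ℕ) + 1 + 1 = m := by omega
    simp [splitAll, h₁, h₂, h₃]

lemma exists_splitDual_eq_zero (a : Fin (k + 2)) : ∃ j, splitDual j = (a, 0) :=
  ⟨⟨a, by omega⟩, by simp [splitDual]⟩

lemma exists_splitFirst_eq (ht : 0 < t) (a : Fin t) :
    ∃ j, splitFirst ht j = (a, if (a : ℕ) = 0 then 1 else 0) := by
  by_cases h : (a : ℕ) = 0
  · exact ⟨Fin.last t, by simp [splitFirst, h, Fin.ext_iff]⟩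
  · simpa [h] using exists_splitFirst_eq_zero ht a

lemma exists_splitAll_eq (ht : 0 < t) (htm : t + 3 ≤ m) (a : Fin (m - 2)) :
    ∃ j, splitAll ht htm j = (a, if (a : ℕ) = 0 ∨ (a : ℕ) = t then 1 else 0) := by
  by_cases h : (a : ℕ) = 0
  · exact ⟨⟨t, by omega⟩, by simp [splitAll, h, Fin.ext_iff]⟩
  by_cases h' : (a : ℕ) = t
  · refine ⟨⟨m - 1, by omega⟩, ?_⟩
    have h₁ : ¬ m - 1 < t := by omega
    have h₂ : ¬ m - 1 = t := by omega
    have h₃ : m - 1 + 1 = m := by omega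
    simp [splitAll, h₁, h₂, h₃, h', Fin.ext_iff]
  · simpa [h, h'] using exists_splitAll_eq_zero ht htm a

lemma exists_splitDual_eq (a : Fin (k + 2)) :
    ∃ j, splitDual j = (a, if k ≤ (a : ℕ) then 1 else 0) := by
  by_cases h : k ≤ (a : ℕ)
  · exact ⟨⟨a + 2, by omega⟩, by simp [splitDual, h]⟩
  · simpa [h] using exists_splitDual_eq_zero a

lemma splitFirst_snd_le (ht : 0 < t) (j : Fin (t + 1)) :
    (splitFirst ht j).2 ≤ if ((splitFirst ht j).1 : ℕ) = 0 then 1 else 0 := by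
  simp only [splitFirst]
  split_ifs <;> simp_all

lemma splitAll_snd_le (ht : 0 < t) (htm : t + 3 ≤ m) (j : Fin m) :
    (splitAll ht htm j).2 ≤
      if ((splitAll ht htm j).1 : ℕ) = 0 ∨ ((splitAll ht htm j).1 : ℕ) = t then 1 else 0 := by
  simp only [splitAll]
  split_ifs <;> simp_all

lemma splitDual_snd_le (j : Fin (k + 4)) :
    (splitDual j).2 ≤ if k ≤ ((splitDual j).1 : ℕ) then 1 else 0 := by
  simp only [splitDual]
  split_ifs <;> (simp_all; try omega)

lemma isSplitting_splitMatrix {r : ℕ} (H : Matrix (Fin m) (Fin n) F) {σ : Fin m → Fin r × ℕ}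
    (hσ : Function.Injective σ) (h₀ : ∀ a, ∃ j, σ j = (a, 0)) :
    IsSplitting H (splitMatrix H σ) :=
  ⟨σ, hσ, h₀, fun _ _ => rfl⟩

lemma splitMatrix_splitFirst_eq_submatrix (ht : 0 < t) (htm : t + 3 ≤ m) (ζ w : Fin n → F)
    (h : t ≤ m - 2) :
    splitMatrix (grsMatrix (t + 1) ζ w) (splitFirst ht) =
      (splitMatrix (grsMatrix m ζ w) (splitAll ht htm)).submatrix (Fin.castLE h) id := by
  ext a b : 1
  simp only [splitMatrix, Matrix.submatrix_apply, Matrix.of_apply, id]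
  have hle : t + 1 ≤ m := by omega
  refine Fintype.sum_of_injective (Fin.castLE hle) (Fin.castLE_injective hle) _ _ ?_ ?_
  · intro j hj
    have hj' : ¬ (j : ℕ) < t + 1 := fun h' => hj ⟨⟨j, h'⟩, rfl⟩
    rw [if_neg]
    have h₁ : ¬ (j : ℕ) < t := by omega
    have h₂ : ¬ (j : ℕ) = t := by omega
    simp only [splitAll, h₁, h₂, dite_false]
    have := a.2
    split_ifs <;> simp [Fin.ext_iff] <;> omega
  · intro j
    have hj := j.2
    by_cases h₁ : (j : ℕ) < t
    · simp [splitAll, splitFirst, h₁, Fin.ext_iff, grsMatrix]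
    · have h₂ : (j : ℕ) = t := by omega
      simp [splitAll, splitFirst, h₂, Fin.ext_iff, grsMatrix]

/-! ### Words orthogonal to the splittings -/

variable {ζ w : Fin n → F} {u : Fin n → F[X]}

/-- `∑ᵢ wᵢ ζᵢ ^ j uᵢ(D)`, the entry `j` of `syndrome (grsMatrix m ζ w) u` for each `m > j`. -/
noncomputable def powerSyndrome (ζ w : Fin n → F) (u : Fin n → F[X]) (j : ℕ) : F[X] :=
  ∑ i, C (w i * ζ i ^ j) * u i

lemma syndrome_grsMatrix (j : Fin m) :
    syndrome (grsMatrix m ζ w) u j = powerSyndrome ζ w u j := rfl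

lemma coeff_powerSyndrome (j s : ℕ) :
    (powerSyndrome ζ w u j).coeff s = ∑ i, w i * ζ i ^ j * (u i).coeff s := by
  simp only [powerSyndrome, finsetSum_coeff, coeff_C_mul]

lemma orthogonal_row_iff_of_single {r : ℕ} {σ : Fin m → Fin r × ℕ} {a : Fin r} {p : ℕ}
    (hpm : p < m) (hp : ∀ j, (σ j).1 = a ↔ (j : ℕ) = p) :
    conjPairing u (splitMatrix (grsMatrix m ζ w) σ a) = 0 ↔ powerSyndrome ζ w u p = 0 := by
  rw [← syndrome_grsMatrix ⟨p, hpm⟩]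
  exact conjPairing_splitMatrix_eq_zero_iff_of_single fun j => (hp j).trans (Fin.ext_iff (b := ⟨p, hpm⟩)).symm

lemma orthogonal_row_iff_of_pair {r : ℕ} {σ : Fin m → Fin r × ℕ} {a : Fin r} {p p' : ℕ}
    (hpm : p < m) (hpm' : p' < m) (hp : ∀ j, (σ j).1 = a ↔ (j : ℕ) = p ∨ (j : ℕ) = p')
    (h₀ : (σ ⟨p, hpm⟩).2 = 0) (h₁ : (σ ⟨p', hpm'⟩).2 = 1) :
    conjPairing u (splitMatrix (grsMatrix m ζ w) σ a) = 0 ↔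
      powerSyndrome ζ w u p' = -X * powerSyndrome ζ w u p := by
  rw [← syndrome_grsMatrix ⟨p, hpm⟩, ← syndrome_grsMatrix ⟨p', hpm'⟩]
  exact conjPairing_splitMatrix_eq_zero_iff_of_pair
    (fun j => (hp j).trans (or_congr (Fin.ext_iff (b := ⟨p, hpm⟩)).symm (Fin.ext_iff (b := ⟨p', hpm'⟩)).symm)) h₀ h₁

lemma orthogonal_splitFirst_iff (ht : 0 < t) :
    (∀ a, conjPairing u (splitMatrix (grsMatrix (t + 1) ζ w) (splitFirst ht) a) = 0) ↔
      powerSyndrome ζ w u t = -X * powerSyndrome ζ w u 0 ∧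
        ∀ j, 0 < j → j < t → powerSyndrome ζ w u j = 0 := by
  have h₀ : conjPairing u (splitMatrix (grsMatrix (t + 1) ζ w) (splitFirst ht) ⟨0, ht⟩) = 0 ↔
      powerSyndrome ζ w u t = -X * powerSyndrome ζ w u 0 := by
    refine orthogonal_row_iff_of_pair (by omega) (by omega) ?_ ?_ ?_
    · intro j
      have := j.2
      simp only [splitFirst]
      split_ifs <;> simp only [Fin.ext_iff, true_iff] <;> omega
    · simp [splitFirst, ht]
    · simp [splitFirst]
  have h₁ : ∀ j (hj : j < t), 0 < j →
      (conjPairing u (splitMatrix (grsMatrix (t + 1) ζ w) (splitFirst ht) ⟨j, hj⟩) = 0 ↔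
        powerSyndrome ζ w u j = 0) := by
    intro j hj hpos
    refine orthogonal_row_iff_of_single (by omega) fun i => ?_
    simp only [splitFirst]
    split_ifs <;> simp only [Fin.ext_iff] <;> omega
  constructor
  · exact fun h => ⟨h₀.1 (h _), fun j hpos hj => (h₁ j hj hpos).1 (h _)⟩
  · rintro ⟨h, h'⟩ ⟨a, ha⟩
    rcases Nat.eq_zero_or_pos a with rfl | hpos
    · exact h₀.2 h
    · exact (h₁ a ha hpos).2 (h' a hpos ha)

lemma orthogonal_splitAll_iff (ht : 0 < t) (htm : t + 3 ≤ m) :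
    (∀ a, conjPairing u (splitMatrix (grsMatrix m ζ w) (splitAll ht htm) a) = 0) ↔
      powerSyndrome ζ w u t = -X * powerSyndrome ζ w u 0 ∧
      powerSyndrome ζ w u (m - 1) = -X * powerSyndrome ζ w u (t + 1) ∧
      ∀ j, j < m → j ≠ 0 → j ≠ t → j ≠ t + 1 → j ≠ m - 1 → powerSyndrome ζ w u j = 0 := by
  have h₀ : conjPairing u
      (splitMatrix (grsMatrix m ζ w) (splitAll ht htm) ⟨0, by omega⟩) = 0 ↔
      powerSyndrome ζ w u t = -X * powerSyndrome ζ w u 0 := by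
    refine orthogonal_row_iff_of_pair (by omega) (by omega) ?_ ?_ ?_
    · intro j
      have := j.2
      simp only [splitAll]
      split_ifs <;> simp only [Fin.ext_iff, true_iff] <;> omega
    · simp [splitAll, ht]
    · simp [splitAll]
  have h₁ : conjPairing u
      (splitMatrix (grsMatrix m ζ w) (splitAll ht htm) ⟨t, by omega⟩) = 0 ↔
      powerSyndrome ζ w u (m - 1) = -X * powerSyndrome ζ w u (t + 1) := by
    refine orthogonal_row_iff_of_pair (by omega) (by omega) ?_ ?_ ?_
    · intro j
      have := j.2
      simp only [splitAll]
      split_ifs <;> simp only [Fin.ext_iff, true_iff] <;> omega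
    · have : ¬ t + 1 + 1 = m := by omega
      simp [splitAll, this]
    · have e₁ : ¬ m - 1 < t := by omega
      have e₂ : ¬ m - 1 = t := by omega
      have e₃ : m - 1 + 1 = m := by omega
      simp [splitAll, e₁, e₂, e₃]
  have h₂ : ∀ j (hj : j < t), 0 < j → (conjPairing u
      (splitMatrix (grsMatrix m ζ w) (splitAll ht htm) ⟨j, by omega⟩) = 0 ↔
        powerSyndrome ζ w u j = 0) := by
    intro j hj hpos
    refine orthogonal_row_iff_of_single (by omega) fun i => ?_
    simp only [splitAll]
    split_ifs <;> simp only [Fin.ext_iff] <;> omega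
  have h₃ : ∀ j (hj : j < m - 1), t + 1 < j → (conjPairing u
      (splitMatrix (grsMatrix m ζ w) (splitAll ht htm) ⟨j - 1, by omega⟩) = 0 ↔
        powerSyndrome ζ w u j = 0) := by
    intro j hj hpos
    refine orthogonal_row_iff_of_single (by omega) fun i => ?_
    simp only [splitAll]
    split_ifs <;> simp only [Fin.ext_iff] <;> omega
  constructor
  · refine fun h => ⟨h₀.1 (h _), h₁.1 (h _), fun j hj hj₀ hjt hjt' hjm => ?_⟩
    by_cases hlt : j < t
    · exact (h₂ j hlt (by omega)).1 (h _)
    · exact (h₃ j (by omega) (by omega)).1 (h _)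
  · rintro ⟨h, h', h''⟩ ⟨a, ha⟩
    rcases Nat.eq_zero_or_pos a with rfl | hpos
    · exact h₀.2 h
    rcases lt_trichotomy a t with hlt | rfl | hgt
    · exact (h₂ a hlt hpos).2 (h'' a (by omega) (by omega) (by omega) (by omega) (by omega))
    · exact h₁.2 h'
    · exact (h₃ (a + 1) (by omega) (by omega)).2
        (h'' (a + 1) (by omega) (by omega) (by omega) (by omega) (by omega))

/-- The dual of the code of the splitting `splitAll`: in the coordinates of the dual basis, its
words have free entries at the indices `0`, `t + 1` and from `m` on, the entries at `t` and `m - 1`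
are `-D` times those at `0` and `t + 1`, and the remaining ones vanish. -/
theorem mem_code_splitDual_iff_inDual {M : Matrix (Fin n) (Fin n) F}
    (hM : grsMatrix n ζ w * M = 1) (ht : 0 < t) (hm : m + k = n) (htm : t + 3 ≤ m) :
    u ∈ code (splitMatrix (signedDualRows M (dualRowIndex hm htm) splitDual) splitDual) ↔
      InDual (code (splitMatrix (grsMatrix m ζ w) (splitAll ht htm))) u := by
  rw [mem_code_splitMatrix_signedDualRows hM (dualRowIndex_injective ht hm htm),
    inDual_code_iff, orthogonal_splitAll_iff]
  simp only [syndrome_grsMatrix]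
  constructor
  · rintro ⟨c, h, h'⟩
    have e₀ := h ⟨k, by omega⟩
    have e₁ := h ⟨k + 1, by omega⟩
    have e₂ := h ⟨k + 2, by omega⟩
    have e₃ := h ⟨k + 3, by omega⟩
    simp [dualRowIndex, splitDual] at e₀ e₁ e₂ e₃
    refine ⟨by rw [e₀, e₂, neg_mul], by rw [e₁, e₃, neg_mul], fun j hj hj₀ hjt hjt' hjm => ?_⟩
    refine h' ⟨j, by omega⟩ ?_
    rintro ⟨p, hp⟩
    simp only [dualRowIndex] at hp
    split_ifs at hp <;> simp only [Fin.mk.injEq] at hp <;> omega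
  · rintro ⟨h, h', h''⟩
    refine ⟨fun a => if (a : ℕ) < k then powerSyndrome ζ w u (m + a)
      else if (a : ℕ) = k then powerSyndrome ζ w u 0 else powerSyndrome ζ w u (t + 1), ?_, ?_⟩
    · rintro ⟨p, hp⟩
      by_cases h₁ : p < k
      · simp [dualRowIndex, splitDual, h₁, show p < k + 2 by omega]
      obtain rfl | rfl | rfl | rfl : p = k ∨ p = k + 1 ∨ p = k + 2 ∨ p = k + 3 := by omega
      · simp [dualRowIndex, splitDual]
      · simp [dualRowIndex, splitDual]
      · simp [dualRowIndex, splitDual, h]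
      · simp [dualRowIndex, splitDual, h']
    · intro j hj
      have hne : ∀ p, (dualRowIndex hm htm p : ℕ) ≠ j := fun p hp => hj ⟨p, Fin.ext hp⟩
      have e₀ := hne ⟨k, by omega⟩
      have e₁ := hne ⟨k + 1, by omega⟩
      have e₂ := hne ⟨k + 2, by omega⟩
      have e₃ := hne ⟨k + 3, by omega⟩
      simp [dualRowIndex] at e₀ e₁ e₂ e₃
      refine h'' j ?_ (by omega) (by omega) (by omega) (by omega)
      by_contra! hge
      have e₄ := hne ⟨j - m, by omega⟩
      simp only [dualRowIndex, show (j : ℕ) - m < k by omega, dite_true] at e₄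
      omega

end Splittings

/-! ### CSS-type stabilizer matrices -/

section CSS

variable {n : ℕ} {ι₁ ι₂ : Type*} {G : Matrix ι₁ (Fin n) F[X]}
  {H : Matrix ι₂ (Fin n) F[X]} {a b : Fin n → F[X]}

lemma mem_code_of_sumElim_left_mem [Fintype ι₁] [Fintype ι₂] :
    Sum.elim a (fun _ => 0) ∈ code (Matrix.fromBlocks G 0 0 H) → a ∈ code G := by
  rintro ⟨c, hc⟩
  refine ⟨fun i => c (Sum.inl i), funext fun j => ?_⟩
  have := congrFun hc (Sum.inl j)
  simpa [Matrix.vecMul, dotProduct] using this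

lemma mem_code_of_sumElim_right_mem [Fintype ι₁] [Fintype ι₂] :
    Sum.elim (fun _ => 0) b ∈ code (Matrix.fromBlocks G 0 0 H) → b ∈ code H := by
  rintro ⟨c, hc⟩
  refine ⟨fun i => c (Sum.inr i), funext fun j => ?_⟩
  have := congrFun hc (Sum.inr j)
  simpa [Matrix.vecMul, dotProduct] using this

lemma IsPhaseShift.eq_sumElim {e : Fin n ⊕ Fin n → F[X]} (h : IsPhaseShift e) :
    e = Sum.elim (fun _ => 0) fun i => e (Sum.inr i) := by
  ext1 (i | i)
  · exact h i
  · rfl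

lemma IsQuditFlip.eq_sumElim {e : Fin n ⊕ Fin n → F[X]} (h : IsQuditFlip e) :
    e = Sum.elim (fun i => e (Sum.inl i)) fun _ => 0 := by
  ext1 (i | i)
  · rfl
  · exact h i

lemma pauliWeight_sumElim_right :
    pauliWeight (Sum.elim (fun _ => 0) b) = ∑ i, (b i).support.card := by
  classical
  simp [pauliWeight]

lemma pauliWeight_sumElim_left :
    pauliWeight (Sum.elim a fun _ => 0) = ∑ i, (a i).support.card := by
  classical
  simp [pauliWeight]

lemma symplecticPairing_fromBlocks_right_iff :
    (∀ i, symplecticPairing (Sum.elim (fun _ => 0) b) (Matrix.fromBlocks G 0 0 H i) = 0) ↔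
      ∀ i, conjPairing b (G i) = 0 := by
  simp [symplecticPairing]

lemma symplecticPairing_fromBlocks_left_iff :
    (∀ i, symplecticPairing (Sum.elim a fun _ => 0) (Matrix.fromBlocks G 0 0 H i) = 0) ↔
      ∀ i, conjPairing a (H i) = 0 := by
  simp [symplecticPairing]

lemma symplecticPairing_fromBlocks (h : ∀ i j, conjPairing (G i) (H j) = 0)
    (i j : ι₁ ⊕ ι₂) :
    symplecticPairing (Matrix.fromBlocks G 0 0 H i) (Matrix.fromBlocks G 0 0 H j) = 0 := by
  rcases i with i | i <;> rcases j with j | j <;> simp [symplecticPairing, h]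
  exact conjPairing_eq_zero_comm.1 (h j i)

end CSS

/-! ### Free distances -/

section Distance

variable {n k m t : ℕ} {ζ w : Fin n → F} {u : Fin n → F[X]}

/-- A nonzero word orthogonal to the rows `h₀ + h_t D`, `h₁`, …, `h_{t-1}` has weight at least
`t + 2`. -/
theorem weight_of_orthogonal_splitFirst (hζ : Function.Injective ζ) (hw : ∀ i, w i ≠ 0)
    (ht : 0 < t) (hu : u ≠ 0)
    (h : ∀ a, conjPairing u (splitMatrix (grsMatrix (t + 1) ζ w) (splitFirst ht) a) = 0) :
    t + 2 ≤ ∑ i, (u i).support.card := by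
  classical
  obtain ⟨hpair, hzero⟩ := (orthogonal_splitFirst_iff ht).1 h
  by_cases h₀ : powerSyndrome ζ w u 0 = 0
  · -- all coefficient vectors are orthogonal to `h₀, …, h_t`
    obtain ⟨i, hi⟩ := Function.ne_iff.1 hu
    have hne : (fun l => (u l).coeff (u i).natDegree) ≠ 0 := fun h' =>
      hi (leadingCoeff_eq_zero.1 (congrFun h' i))
    have hlt : t + 1 < hammingNorm fun l => (u l).coeff (u i).natDegree := by
      refine lt_hammingNorm_of_syndromes hζ hw hne fun j hj => ?_
      rw [← coeff_powerSyndrome]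
      suffices powerSyndrome ζ w u j = 0 by simp [this]
      rcases Nat.eq_zero_or_pos j with rfl | hpos
      · exact h₀
      rcases (Nat.lt_succ_iff.1 hj).lt_or_eq with hlt | rfl
      · exact hzero j hpos hlt
      · rw [hpair, h₀, mul_zero]
    have := sum_hammingNorm_coeff_le u {(u i).natDegree}
    rw [Finset.sum_singleton] at this
    omega
  · -- the top coefficient vector is orthogonal to `h₀, …, h_{t-1}`, and `u` is not a monomial
    set d := Finset.univ.sup fun i => (u i).natDegree with hd
    have hdeg : ∀ i, (u i).natDegree ≤ d := fun i =>
      Finset.le_sup (f := fun i => (u i).natDegree) (Finset.mem_univ i)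
    have htop : (fun i => (u i).coeff d) ≠ 0 := by
      intro hcoeff
      obtain ⟨i₀, hi₀⟩ := Function.ne_iff.1 hu
      obtain ⟨i, -, hi⟩ := Finset.exists_mem_eq_sup Finset.univ ⟨i₀, Finset.mem_univ i₀⟩
        fun i => (u i).natDegree
      have hui : u i = 0 := by
        have := congrFun hcoeff i
        simp only [hd, hi] at this
        exact leadingCoeff_eq_zero.1 this
      have hd0 : d = 0 := by rw [hd, hi, hui, natDegree_zero]
      have h₁ := congrFun hcoeff i₀
      have h₂ := hdeg i₀
      rw [hd0] at h₁ h₂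
      rw [Nat.le_zero] at h₂
      rw [eq_C_of_natDegree_eq_zero h₂] at hi₀
      simp only [Pi.zero_apply] at h₁
      simp [h₁] at hi₀
    have htop₀ : (powerSyndrome ζ w u 0).coeff d = 0 := by
      have h₁ : (powerSyndrome ζ w u t).coeff (d + 1) = 0 := by
        rw [coeff_powerSyndrome]
        refine Finset.sum_eq_zero fun i _ => ?_
        rw [coeff_eq_zero_of_natDegree_lt (Nat.lt_succ_of_le (hdeg i)), mul_zero]
      rw [hpair, neg_mul, coeff_neg, coeff_X_mul, neg_eq_zero] at h₁
      exact h₁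
    have hlt : t < hammingNorm fun i => (u i).coeff d := by
      refine lt_hammingNorm_of_syndromes hζ hw htop fun j hj => ?_
      rw [← coeff_powerSyndrome]
      rcases Nat.eq_zero_or_pos j with rfl | hpos
      · exact htop₀
      · rw [hzero j hpos hj, coeff_zero]
    obtain ⟨s, hs⟩ : ∃ s, (powerSyndrome ζ w u 0).coeff s ≠ 0 := by
      by_contra! hall
      exact h₀ (Polynomial.ext fun s => by simpa using hall s)
    have hsd : s ≠ d := by
      rintro rfl
      exact hs htop₀
    have hpos : 0 < hammingNorm fun i => (u i).coeff s := by
      rw [hammingNorm_pos_iff]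
      intro h'
      rw [coeff_powerSyndrome] at hs
      refine hs (Finset.sum_eq_zero fun i _ => ?_)
      rw [show (u i).coeff s = 0 from congrFun h' i, mul_zero]
    have := sum_hammingNorm_coeff_le u {d, s}
    rw [Finset.sum_pair hsd.symm] at this
    omega

/-- If a convolutional code contains the constant words of `GRS_k(ζ, v)`, then the coefficient
vectors of the words orthogonal to it lie in the dual of `GRS_k(ζ, v)`, which has minimum distance
`k + 1`. -/
theorem weight_of_inDual {C' : Submodule F[X] (Fin n → F[X])} (hζ : Function.Injective ζ)
    {v : Fin n → F} (hv : ∀ i, v i ≠ 0) (hC : ∀ c ∈ GRS k ζ v, (fun i => C (c i)) ∈ C')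
    (hu : u ≠ 0) (h : InDual C' u) : k + 1 ≤ ∑ i, (u i).support.card := by
  classical
  obtain ⟨i, hi⟩ := Function.ne_iff.1 hu
  have hne : (fun l => (u l).coeff (u i).natDegree) ≠ 0 := fun h' =>
    hi (leadingCoeff_eq_zero.1 (congrFun h' i))
  have hlt : k < hammingNorm fun l => (u l).coeff (u i).natDegree := by
    refine lt_hammingNorm_of_orthogonal hζ hv hne fun f hf => ?_
    have h₁ := h _ (hC (fun i => v i * f.eval (ζ i)) (mem_GRS_iff.2 ⟨f, hf, fun _ => rfl⟩))
    have h₂ : conjPairing u (fun i => C (v i * f.eval (ζ i))) =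
        toLaurent (∑ i, C (v i * f.eval (ζ i)) * u i) := by
      simp only [conjPairing, toLaurent_C, LaurentPolynomial.invert_C, map_sum, map_mul]
      exact Finset.sum_congr rfl fun i _ => mul_comm _ _
    rw [h₂, toLaurent_eq_zero] at h₁
    have h₃ := congrArg (fun p => p.coeff (u i).natDegree) h₁
    simpa only [finsetSum_coeff, coeff_C_mul, coeff_zero] using h₃
  have := sum_hammingNorm_coeff_le u {(u i).natDegree}
  rw [Finset.sum_singleton] at this
  omega

lemma const_mem_code_of_mem_GRS {v : Fin n → F} {M : Matrix (Fin n) (Fin n) F} (hM : grsMatrix n ζ w * M = 1) (ht : 0 < t) (hm : m + k = n)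
    (htm : t + 3 ≤ m) (hpar : IsParityCheckMatrix (grsMatrix m ζ w) (GRS k ζ v))
    {c : Fin n → F} (hc : c ∈ GRS k ζ v) :
    (fun i => C (c i)) ∈
      code (splitMatrix (signedDualRows M (dualRowIndex hm htm) splitDual) splitDual) := by
  have hzero : ∀ j < m, powerSyndrome ζ w (fun i => C (c i)) j = 0 := by
    intro j hj
    have := congrFun ((hpar.2 c).1 hc) ⟨j, hj⟩
    simp only [powerSyndrome, ← C_mul, ← map_sum]
    rw [C_eq_zero]
    simpa [Matrix.mulVec, dotProduct, grsMatrix] using this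
  rw [mem_code_splitDual_iff_inDual hM ht, inDual_code_iff, orthogonal_splitAll_iff,
    hzero _ (by omega), hzero _ (by omega), hzero _ (by omega), hzero _ (by omega), mul_zero]
  exact ⟨rfl, rfl, fun j hj _ _ _ _ => hzero j hj⟩

/-- The constant word given by column `t + 1` of the dual basis is orthogonal to the rows of the
splitting of `h₀, …, h_t`, but not to the row `h_{t+1} + h_{m-1} D`. -/
lemma exists_orthogonal_splitFirst_not_inDual {M : Matrix (Fin n) (Fin n) F}
    (hM : grsMatrix n ζ w * M = 1) (ht : 0 < t) (hm : m ≤ n)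
    (htm : t + 3 ≤ m) :
    ∃ u : Fin n → F[X],
      (∀ a, conjPairing u (splitMatrix (grsMatrix (t + 1) ζ w) (splitFirst ht) a) = 0) ∧
      ¬ InDual (code (splitMatrix (grsMatrix m ζ w) (splitAll ht htm))) u := by
  have hs : ∀ j < n, powerSyndrome ζ w (fun i => C (M i ⟨t + 1, by omega⟩)) j =
      if j = t + 1 then 1 else 0 := by
    intro j hj
    have := congrFun (congrFun hM ⟨j, hj⟩) ⟨t + 1, by omega⟩
    simp only [Matrix.mul_apply, grsMatrix, Matrix.of_apply, Matrix.one_apply, Fin.mk.injEq]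
      at this
    simp only [powerSyndrome, ← C_mul, ← map_sum, this]
    split_ifs <;> simp
  refine ⟨fun i => C (M i ⟨t + 1, by omega⟩), ?_, ?_⟩
  · rw [orthogonal_splitFirst_iff, hs _ (by omega), hs _ (by omega), if_neg (by omega),
      if_neg (by omega), mul_zero]
    refine ⟨rfl, fun j _ hj => ?_⟩
    rw [hs _ (by omega), if_neg (by omega)]
  · rw [inDual_code_iff, orthogonal_splitAll_iff]
    rintro ⟨-, h, -⟩
    rw [hs _ (by omega), hs _ (by omega), if_neg (by omega), if_pos rfl, mul_one] at h
    exact X_ne_zero (neg_eq_zero.1 h.symm)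

end Distance

/-- The rows of a basic matrix are independent: no row lies in the code generated by others. -/
lemma row_notMem_code_submatrix {ι ι' κ : Type*} [Fintype κ] [Fintype ι'] [DecidableEq ι]
    {G : Matrix ι κ F[X]} (hG : IsBasic G) (ρ : ι' → ι) {a : ι} (ha : ∀ i, ρ i ≠ a) :
    G a ∉ code (G.submatrix ρ id) := by
  obtain ⟨R, hR⟩ := hG
  rintro ⟨c, hc⟩
  have h : Matrix.vecMul (Matrix.vecMul c (G.submatrix ρ id)) R a = 0 := by
    have hsub : G.submatrix ρ id * R = (1 : Matrix ι ι F[X]).submatrix ρ id := by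
      rw [← hR]
      rfl
    rw [Matrix.vecMul_vecMul, hsub]
    simp [Matrix.vecMul, dotProduct, ha]
  have h' : (G * R) a a = 0 := by
    rw [← h]
    change _ = Matrix.vecMul (Matrix.vecMulLinear _ c) R a
    rw [hc]
    rfl
  simp [hR] at h'

end AQCC

open AQCC in
theorem theorem7 {F : Type*} [Field F] [Fintype F] (q n k t : ℕ)
    (hF : Fintype.card F = q) (hq : 5 ≤ q) (hn : 5 ≤ n) (hnq : n ≤ q)
    (hk : 1 ≤ k) (hkn : k + 4 ≤ n) (ht : 1 ≤ t) (htn : t + k + 3 ≤ n)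
    (ζ v : Fin n → F) (hζ : Function.Injective ζ) (hv : ∀ i, v i ≠ 0) :
    -- a parity check matrix of `GRS_k(ζ, v)`, with rows `(wᵢ ζᵢ ^ j)ᵢ` for `j < n - k`
    ∃ w : Fin n → F, (∀ i, w i ≠ 0) ∧
      AQCC.IsParityCheckMatrix (AQCC.grsMatrix (n - k) ζ w) (AQCC.GRS k ζ v) ∧
    -- it is split into a reduced basic matrix `G₁`, and its first `t + 1` rows into `G₂`,
    -- whose rows are rows of `G₁`; `H₁` generates the dual of the code of `G₁`
    ∃ (G₁ : Matrix (Fin (n - k - 2)) (Fin n) (Polynomial F))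
      (G₂ : Matrix (Fin t) (Fin n) (Polynomial F))
      (H₁ : Matrix (Fin (k + 2)) (Fin n) (Polynomial F))
      (ρ : Fin t → Fin (n - k - 2)),
      AQCC.IsSplitting (AQCC.grsMatrix (n - k) ζ w) G₁ ∧
      AQCC.IsSplitting (AQCC.grsMatrix (t + 1) ζ w) G₂ ∧
      Function.Injective ρ ∧ G₂ = G₁.submatrix ρ id ∧
      AQCC.IsReducedBasic G₁ ∧ AQCC.IsReducedBasic G₂ ∧ AQCC.IsReducedBasic H₁ ∧
      (∀ u, u ∈ AQCC.code H₁ ↔ AQCC.InDual (AQCC.code G₁) u) ∧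
    -- the resulting CSS-type code is the asserted one
    ∃ μ dz dx : ℕ,
      AQCC.IsAQCC (Matrix.fromBlocks G₂ 0 0 H₁) (n - t - k - 2) μ 3 dz dx ∧
      t + 2 ≤ dz ∧ k + 1 ≤ dx ∧
      -- the same bounds when the larger of the two distances is named first
      max (t + 2) (k + 1) ≤ max dz dx ∧ min (t + 2) (k + 1) ≤ min dz dx := by
  have htm : t + 3 ≤ n - k := by omega
  have hm : n - k + k = n := by omega
  set w := dualWeight ζ v
  have hw : ∀ i, w i ≠ 0 := dualWeight_ne_zero hζ hv
  have hpar : IsParityCheckMatrix (grsMatrix (n - k) ζ w) (GRS k ζ v) :=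
    isParityCheckMatrix_grsMatrix hζ hv (by omega)
  obtain ⟨M, hM⟩ := exists_grsMatrix_mul_eq_one hζ hw
  obtain ⟨R₁, hR₁⟩ := exists_grsMatrix_mul_eq_one_of_le hζ hw (Nat.sub_le n k)
  obtain ⟨R₂, hR₂⟩ := exists_grsMatrix_mul_eq_one_of_le hζ hw (show t + 1 ≤ n by omega)
  set B := signedDualRows M (dualRowIndex hm htm) splitDual with hB
  obtain ⟨R, hR⟩ : ∃ R : Matrix (Fin n) (Fin (k + 4)) F, B * R = 1 :=
    exists_signedDualRows_mul_eq_one hM (dualRowIndex_injective ht hm htm) _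
  set G₁ := splitMatrix (grsMatrix (n - k) ζ w) (splitAll ht htm) with hG₁
  set G₂ := splitMatrix (grsMatrix (t + 1) ζ w) (splitFirst ht) with hG₂
  set H₁ := splitMatrix B splitDual with hH₁
  have hle : t ≤ n - k - 2 := by omega
  have hsub : G₂ = G₁.submatrix (Fin.castLE hle) id :=
    splitMatrix_splitFirst_eq_submatrix ht htm ζ w hle
  have bG₁ : IsBasic G₁ := isBasic_splitMatrix hR₁ (exists_splitAll_eq_zero ht htm)
  have bG₂ : IsBasic G₂ := isBasic_splitMatrix hR₂ (exists_splitFirst_eq_zero ht)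
  have bH₁ : IsBasic H₁ := isBasic_splitMatrix hR exists_splitDual_eq_zero
  have lG₁ := linearIndependent_leadingRowCoeff_splitMatrix hR₁ (splitAll_injective ht htm)
    (exists_splitAll_eq ht htm) (splitAll_snd_le ht htm)
  have lG₂ := linearIndependent_leadingRowCoeff_splitMatrix hR₂ (splitFirst_injective ht)
    (exists_splitFirst_eq ht) (splitFirst_snd_le ht)
  have lH₁ := linearIndependent_leadingRowCoeff_splitMatrix hR splitDual_injective
    exists_splitDual_eq splitDual_snd_le
  have hdual : ∀ u, u ∈ code H₁ ↔ InDual (code G₁) u := fun u =>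
    mem_code_splitDual_iff_inDual hM ht hm htm
  have horth : ∀ i j, conjPairing (G₁ i) (H₁ j) = 0 := fun i j =>
    conjPairing_eq_zero_comm.1
      (inDual_code_iff.1 ((hdual _).1 ⟨Pi.single j 1, by simp [Matrix.row]⟩) i)
  have dG₂ : overallConstraintLength G₂ = 1 := by
    have : ∀ a, rowDegree G₂ a = if a = ⟨0, ht⟩ then 1 else 0 := fun a => by
      rw [hG₂, rowDegree_splitMatrix hR₂ (splitFirst_injective ht) (exists_splitFirst_eq ht)
        (splitFirst_snd_le ht)]
      simp [Fin.ext_iff]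
    simp [overallConstraintLength, this]
  have dH₁ : overallConstraintLength H₁ = 2 := by
    have : ∀ a, rowDegree H₁ a = if k ≤ (a : ℕ) then 1 else 0 := fun a => by
      rw [hH₁, rowDegree_splitMatrix hR splitDual_injective exists_splitDual_eq splitDual_snd_le]
    simp only [overallConstraintLength, this]
    rw [Fin.sum_univ_castSucc, Fin.sum_univ_castSucc]
    simp
  set S := Matrix.fromBlocks G₂ 0 0 H₁ with hS
  have hphase : ∃ e, IsUndetectable S e ∧ IsPhaseShift e := by
    obtain ⟨u, hu, hu'⟩ := exists_orthogonal_splitFirst_not_inDual hM ht (Nat.sub_le n k) htm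
    exact ⟨Sum.elim (fun _ => 0) u, ⟨symplecticPairing_fromBlocks_right_iff.2 hu, fun h =>
      hu' ((hdual u).1 (mem_code_of_sumElim_right_mem h))⟩, fun _ => rfl⟩
  have hflip : ∃ e, IsUndetectable S e ∧ IsQuditFlip e := by
    -- row `t` of `G₁` is orthogonal to `H₁`, and it is not a row of `G₂`
    refine ⟨Sum.elim (G₁ ⟨t, by omega⟩) fun _ => 0,
      ⟨symplecticPairing_fromBlocks_left_iff.2 (horth _), fun h => ?_⟩, fun _ => rfl⟩
    have h' := mem_code_of_sumElim_left_mem h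
    rw [hsub] at h'
    refine row_notMem_code_submatrix bG₁ _ (fun i hi => ?_) h'
    have := i.2
    have := congrArg Fin.val hi
    simp at this
    omega
  have hphase_le : ∀ e, IsUndetectable S e → IsPhaseShift e → t + 2 ≤ pauliWeight e := by
    rintro e ⟨he, he'⟩ hz
    rw [hz.eq_sumElim] at he he' ⊢
    rw [pauliWeight_sumElim_right]
    refine weight_of_orthogonal_splitFirst hζ hw ht ?_
      (symplecticPairing_fromBlocks_right_iff.1 he)
    intro h0
    refine he' ?_
    rw [h0]
    convert (code S).zero_mem using 1
    ext1 (i | i) <;> rfl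
  have hflip_le : ∀ e, IsUndetectable S e → IsQuditFlip e → k + 1 ≤ pauliWeight e := by
    rintro e ⟨he, he'⟩ hx
    rw [hx.eq_sumElim] at he he' ⊢
    rw [pauliWeight_sumElim_left]
    refine weight_of_inDual hζ hv (C' := code H₁)
      (fun c hc => const_mem_code_of_mem_GRS hM ht hm htm hpar hc) ?_
      (inDual_code_iff.2 (symplecticPairing_fromBlocks_left_iff.1 he))
    intro h0
    refine he' ?_
    rw [h0]
    convert (code S).zero_mem using 1
    ext1 (i | i) <;> rfl
  have hleast : ∀ s : Set ℕ, s.Nonempty → IsLeast s (sInf s) := fun s hs =>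
    ⟨Nat.sInf_mem hs, fun _ => Nat.sInf_le⟩
  obtain ⟨dz, hdz⟩ : ∃ dz,
      IsLeast {w | ∃ e, IsUndetectable S e ∧ IsPhaseShift e ∧ pauliWeight e = w} dz := by
    obtain ⟨e, he, he'⟩ := hphase
    exact ⟨_, hleast _ ⟨_, e, he, he', rfl⟩⟩
  obtain ⟨dx, hdx⟩ : ∃ dx,
      IsLeast {w | ∃ e, IsUndetectable S e ∧ IsQuditFlip e ∧ pauliWeight e = w} dx := by
    obtain ⟨e, he, he'⟩ := hflip
    exact ⟨_, hleast _ ⟨_, e, he, he', rfl⟩⟩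
  have hz : t + 2 ≤ dz := by
    obtain ⟨e, he, he', rfl⟩ := hdz.1
    exact hphase_le e he he'
  have hx : k + 1 ≤ dx := by
    obtain ⟨e, he, he', rfl⟩ := hdx.1
    exact hflip_le e he he'
  refine ⟨w, hw, hpar, G₁, G₂, H₁, Fin.castLE hle,
    isSplitting_splitMatrix _ (splitAll_injective ht htm) (exists_splitAll_eq_zero ht htm),
    isSplitting_splitMatrix _ (splitFirst_injective ht) (exists_splitFirst_eq_zero ht),
    Fin.castLE_injective hle, hsub, isReducedBasic_of_linearIndependent bG₁ lG₁,
    isReducedBasic_of_linearIndependent bG₂ lG₂, isReducedBasic_of_linearIndependent bH₁ lH₁,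
    hdual, memory S, dz, dx, ⟨?_, ?_, ?_, rfl, ?_, hdz, hdx⟩, hz, hx,
    max_le_max hz hx, min_le_min hz hx⟩
  · refine isReducedBasic_of_linearIndependent (bG₂.fromBlocks bH₁) ?_
    rw [leadingRowCoeff_fromBlocks]
    exact linearIndependent_row_fromBlocks lG₂ lH₁
  · refine symplecticPairing_fromBlocks fun i j => ?_
    rw [hsub]
    exact horth _ j
  · simp only [Fintype.card_sum, Fintype.card_fin]
    omega
  · rw [overallConstraintLength_fromBlocks, dG₂, dH₁]
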